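/- Let $(B,\Sigma,\mu)$ be a probability space and let $\mathcal{B}\subseteq\Sigma$ be a countable family of measurable sets (the test sets). The VC-dimension $d_{\mathcal{B}}$ of $\mathcal{B}$ is the largest cardinality of a set $P\subseteq B$ such that $\{P\cap T : T\in\mathcal{B}\}$ contains all subsets of $P$; assume that it is finite and $d_{\mathcal{B}}\ge 1$. For $\mathcal{P}\subseteq B$ define the $(\mathcal{B},\mu)$-dispersion $$\mathrm{disp}_\mu(\mathcal{P};\mathcal{B}) := \sup\{\mu(T) : T\in\mathcal{B},\ T\cap\mathcal{P}=\emptyset\},$$ with $\sup\emptyset := 0$. Let $n\in\mathbb{N}$ with $n\ge d_{\mathcal{B}}$, let $X_1,\dots,X_n$ be independent $B$-valued random variables on a probability space $(\Omega,\mathcal{A},\mathbb{P})$, each with distribution $\mu$, and put $\mathcal{P}_n:=\{X_1,\dots,X_n\}$. Then $\mathrm{disp}_\mu(\mathcal{P}_n;\mathcal{B})$ is integrable and $$\mathbb{E}\big[\mathrm{disp}_\mu(\mathcal{P}_n;\mathcal{B})\big]\le \frac{4d_{\mathcal{B}}}{n}\,\log_2\!\left(\frac{e\,n}{d_{\mathcal{B}}}\right).$$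 -/

import Mathlib

open MeasureTheory ProbabilityTheory

/-- `𝓑` shatters `P` if every subset of `P` is the intersection of `P` with a member of `𝓑`. -/
def SetShatters {B : Type*} (𝓑 : Set (Set B)) (P : Set B) : Prop :=
  ∀ S ⊆ P, ∃ T ∈ 𝓑, P ∩ T = S

/-- The Vapnik–Chervonenkis dimension of a family of sets: the largest cardinality of a shattered
set (`⊤` if shattered sets can be arbitrarily large). -/
noncomputable def setVCDim {B : Type*} (𝓑 : Set (Set B)) : ℕ∞ :=
  ⨆ P ∈ {P : Set B | SetShatters 𝓑 P}, P.encard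

/-- The `(𝓑, μ)`-dispersion of a point set `P`: the supremum of the measures of the test sets that
contain no point of `P` (it is `0` if there are no such test sets). -/
noncomputable def dispersion {B : Type*} [MeasurableSpace B] (μ : Measure B) (𝓑 : Set (Set B))
    (P : Set B) : ℝ :=
  sSup {r : ℝ | ∃ T ∈ 𝓑, T ∩ P = ∅ ∧ r = μ.real T}

/-!
The sample `x` of size `n` is compared with an independent ghost sample `y` of the same size. If a
test set `T` misses `x`, then the expectation over `y` of `2 ^ #{i | y i ∈ T}` is
`(1 + μ T) ^ n ≥ 2 ^ (n * μ T)`. Hence `2 ^ (n * disp)` is at most one plus the expectation over `y`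
of the supremum, over the traces on the double sample `(x, y)` that miss `x`, of `2` to the number
of ghost points in the trace; the extra one covers samples that meet every test set. Exchanging
`x i` and `y i` independently at random does not change the law of the double sample, and it gives
each fixed trace an expected weight of at most one: a pair with exactly one point in the trace
contributes `(0 + 2) / 2`, a pair with two points `0`, a pair with none `1`. A union bound and the
Sauer–Shelah lemma therefore give
`𝔼 2 ^ (n * disp) ≤ 1 + ∑ k ≤ d, (2 * n).choose k ≤ (4 * e * n / d) ^ d`, and Jensen's inequality
for `r ↦ 2 ^ r` turns this into the bound on `𝔼 disp`.
-/

open scoped ENNReal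

section Combinatorics

variable {B κ : Type*} {𝓑 : Set (Set B)}

lemma SetShatters.encard_le_setVCDim {P : Set B} (hP : SetShatters 𝓑 P) :
    P.encard ≤ setVCDim 𝓑 :=
  le_iSup₂ (f := fun (P : Set B) (_ : P ∈ {P : Set B | SetShatters 𝓑 P}) => P.encard) P hP

open Finset in
theorem encard_le_sum_choose_of_setVCDim_le [Fintype κ] {𝓒 : Set (Set κ)} {d : ℕ}
    (hd : setVCDim 𝓒 ≤ d) : 𝓒.encard ≤ (∑ k ∈ Iic d, (Fintype.card κ).choose k : ℕ) := by
  classical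
  let 𝒜 : Finset (Finset κ) := {S | (S : Set κ) ∈ 𝓒}
  have h_encard : 𝓒.encard = #𝒜 := by
    rw [← Set.encard_preimage_of_bijective Fintype.finsetEquivSet.bijective,
      ← Set.encard_coe_eq_coe_finsetCard]
    simp [𝒜, Set.preimage]
  have h_vcDim : 𝒜.vcDim ≤ d := by
    refine Finset.sup_le fun J hJ => ?_
    have hJ_shatters : SetShatters 𝓒 J := by
      intro S hS
      lift S to Finset κ using S.toFinite
      obtain ⟨T, hT, hJT⟩ := mem_shatterer.1 hJ (coe_subset.1 hS)
      exact ⟨T, by simpa [𝒜] using hT, by rw [← hJT, coe_inter]⟩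
    have := hJ_shatters.encard_le_setVCDim.trans hd
    rwa [Set.encard_coe_eq_coe_finsetCard, Nat.cast_le] at this
  rw [h_encard, Nat.cast_le]
  calc #𝒜 ≤ #𝒜.shatterer := card_le_card_shatterer 𝒜
    _ ≤ ∑ k ∈ Iic 𝒜.vcDim, (Fintype.card κ).choose k := card_shatterer_le_sum_vcDim
    _ ≤ ∑ k ∈ Iic d, (Fintype.card κ).choose k := by gcongr

/-- The traces of the family `𝓑` on the indexed points `z`, encoded as sets of indices rather than
as subsets of `Set.range z`, so that repeated points are kept apart. -/
def traces (𝓑 : Set (Set B)) (z : κ → B) : Set (Set κ) :=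
  (z ⁻¹' ·) '' 𝓑

lemma traces_comp (z : κ → B) {κ' : Type*} (σ : κ' → κ) :
    traces 𝓑 (z ∘ σ) = (σ ⁻¹' ·) '' traces 𝓑 z := by
  simp only [traces, Set.image_image, Set.preimage_comp]

lemma SetShatters.injOn_of_traces {z : κ → B} {P : Set κ} (hP : SetShatters (traces 𝓑 z) P) :
    Set.InjOn z P := by
  intro i hi j hj hij
  obtain ⟨_, ⟨T, -, rfl⟩, hT⟩ := hP {i} (Set.singleton_subset_iff.2 hi)
  have hiT : z i ∈ T := (hT.ge rfl).2
  have hji : j ∈ ({i} : Set κ) := hT.le ⟨hj, show z j ∈ T from hij ▸ hiT⟩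
  exact (Set.mem_singleton_iff.1 hji).symm

lemma SetShatters.image_of_traces {z : κ → B} {P : Set κ} (hP : SetShatters (traces 𝓑 z) P) :
    SetShatters 𝓑 (z '' P) := by
  intro Q hQ
  obtain ⟨_, ⟨T, hT𝓑, rfl⟩, hT⟩ := hP (P ∩ z ⁻¹' Q) Set.inter_subset_left
  refine ⟨T, hT𝓑, ?_⟩
  rw [← Set.image_inter_preimage, hT, Set.image_inter_preimage, Set.inter_eq_right.2 hQ]

lemma setVCDim_traces_le (𝓑 : Set (Set B)) (z : κ → B) : setVCDim (traces 𝓑 z) ≤ setVCDim 𝓑 :=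
  iSup₂_le fun P (hP : SetShatters (traces 𝓑 z) P) => by
    rw [← hP.injOn_of_traces.encard_image]
    exact hP.image_of_traces.encard_le_setVCDim

lemma sum_choose_le_exp_mul_div_pow {N d : ℕ} (hd : 0 < d) (hdN : d ≤ N) :
    ∑ k ∈ Finset.Iic d, (N.choose k : ℝ) ≤ (Real.exp 1 * N / d) ^ d := by
  have hN : 0 < N := hd.trans_le hdN
  set q : ℝ := d / N with hq
  have hq_pos : 0 < q := by positivity
  have hq_le : q ≤ 1 := (div_le_one (by positivity)).2 (by exact_mod_cast hdN)
  have h_binomial : (∑ k ∈ Finset.Iic d, (N.choose k : ℝ)) * q ^ d ≤ (q + 1) ^ N := by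
    calc (∑ k ∈ Finset.Iic d, (N.choose k : ℝ)) * q ^ d
        = ∑ k ∈ Finset.Iic d, (N.choose k : ℝ) * q ^ d := Finset.sum_mul ..
      _ ≤ ∑ k ∈ Finset.Iic d, (N.choose k : ℝ) * q ^ k := by
          gcongr ∑ k ∈ _, _ * ?_ with k hk
          exact pow_le_pow_of_le_one hq_pos.le hq_le (Finset.mem_Iic.1 hk)
      _ ≤ ∑ k ∈ Finset.range (N + 1), (N.choose k : ℝ) * q ^ k := by
          refine Finset.sum_le_sum_of_subset_of_nonneg (fun k hk => ?_) fun _ _ _ => by positivity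
          exact Finset.mem_range_succ_iff.2 ((Finset.mem_Iic.1 hk).trans hdN)
      _ = (q + 1) ^ N := by simp only [add_pow, one_pow, mul_one, mul_comm]
  have h_exp : (q + 1) ^ N ≤ Real.exp 1 ^ d := by
    calc (q + 1) ^ N ≤ Real.exp q ^ N := by gcongr; exact Real.add_one_le_exp q
      _ = Real.exp 1 ^ d := by
          rw [← Real.exp_nat_mul, ← Real.exp_nat_mul, hq]
          field_simp
  calc ∑ k ∈ Finset.Iic d, (N.choose k : ℝ)
      ≤ Real.exp 1 ^ d / q ^ d := (le_div_iff₀ (by positivity)).2 (h_binomial.trans h_exp)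
    _ = (Real.exp 1 * N / d) ^ d := by rw [← div_pow, hq, div_div_eq_mul_div]

lemma logb_one_add_sum_choose_two_mul_le {n d : ℕ} (hd : 0 < d) (hdn : d ≤ 2 * n) :
    Real.logb 2 (1 + ∑ k ∈ Finset.Iic d, ((2 * n).choose k : ℝ)) ≤
      d * Real.logb 2 (4 * (Real.exp 1 * n / d)) := by
  have h_one : (1 : ℝ) ≤ ∑ k ∈ Finset.Iic d, ((2 * n).choose k : ℝ) := by
    simpa using Finset.single_le_sum (f := fun k => ((2 * n).choose k : ℝ))
      (fun _ _ => Nat.cast_nonneg _) (Finset.mem_Iic.2 d.zero_le)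
  rw [← Real.logb_pow]
  refine Real.logb_le_logb_of_le one_lt_two (by positivity) ?_
  calc 1 + ∑ k ∈ Finset.Iic d, ((2 * n).choose k : ℝ)
      ≤ 2 * ∑ k ∈ Finset.Iic d, ((2 * n).choose k : ℝ) := by linarith
    _ ≤ 2 ^ d * (Real.exp 1 * (2 * n : ℕ) / d) ^ d := by
        gcongr
        · exact le_self_pow₀ one_le_two hd.ne'
        · exact sum_choose_le_exp_mul_div_pow hd hdn
    _ = (4 * (Real.exp 1 * n / d)) ^ d := by
        rw [← mul_pow]
        push_cast
        ring

end Combinatorics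

section Symmetrization

variable {B κ : Type*} {𝓑 : Set (Set B)}

lemma sum_iSup_traces_comp_le {τ : Type*} [Fintype τ] (σ : τ → κ → κ) {w : Set κ → ℝ≥0∞}
    (hw : ∀ S, ∑ t, w (σ t ⁻¹' S) ≤ Fintype.card τ) (z : κ → B) :
    ∑ t, ⨆ S ∈ traces 𝓑 (z ∘ σ t), w S ≤ (traces 𝓑 z).encard * Fintype.card τ := by
  calc ∑ t, ⨆ S ∈ traces 𝓑 (z ∘ σ t), w S
      = ∑ t, ⨆ S : traces 𝓑 z, w (σ t ⁻¹' S) := by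
        simp only [traces_comp, iSup_image, iSup_subtype']
    _ ≤ ∑ t, ∑' S : traces 𝓑 z, w (σ t ⁻¹' S) := by
        gcongr with t
        exact iSup_le fun S => ENNReal.le_tsum S
    _ = ∑' S : traces 𝓑 z, ∑ t, w (σ t ⁻¹' S) :=
        (Summable.tsum_finsetSum fun _ _ => ENNReal.summable).symm
    _ ≤ ∑' _ : traces 𝓑 z, (Fintype.card τ : ℝ≥0∞) := by gcongr with S; exact hw S
    _ = (traces 𝓑 z).encard * Fintype.card τ := ENNReal.tsum_set_const _ _

variable [MeasurableSpace B]

lemma measurable_iSup_traces [Finite κ] (h𝓑_countable : 𝓑.Countable)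
    (h𝓑_meas : ∀ T ∈ 𝓑, MeasurableSet T) (w : Set κ → ℝ≥0∞) :
    Measurable fun z : κ → B => ⨆ S ∈ traces 𝓑 z, w S := by
  simp only [traces, iSup_image]
  refine Measurable.biSup 𝓑 h𝓑_countable fun T hT => (Measurable.of_discrete (f := w)).comp ?_
  exact measurable_set_iff.2 fun k => (h𝓑_meas T hT).mem.comp (measurable_pi_apply k)

variable [Fintype κ] {μ : Measure B}

lemma measurePreserving_comp_perm [SigmaFinite μ] (σ : Equiv.Perm κ) :
    MeasurePreserving (fun z : κ → B => z ∘ σ) (Measure.pi fun _ => μ) (Measure.pi fun _ => μ) :=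
  (measurePreserving_piCongrLeft (fun _ : κ => μ) σ).symm

/-- The symmetrization principle: permuting the coordinates does not change the law of an i.i.d.
sample, so the weight of a trace may be replaced by its average over the permutations `σ t`, after
which a union bound over the traces of each fixed sample costs only their number. -/
theorem lintegral_iSup_traces_le [IsProbabilityMeasure μ] (h𝓑_countable : 𝓑.Countable)
    (h𝓑_meas : ∀ T ∈ 𝓑, MeasurableSet T) {C : ℕ} (hC : ∀ z : κ → B, (traces 𝓑 z).encard ≤ C)
    {τ : Type*} [Fintype τ] [Nonempty τ] (σ : τ → Equiv.Perm κ) {w : Set κ → ℝ≥0∞}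
    (hw : ∀ S, ∑ t, w (σ t ⁻¹' S) ≤ Fintype.card τ) :
    ∫⁻ z, ⨆ S ∈ traces 𝓑 z, w S ∂Measure.pi (fun _ : κ => μ) ≤ C := by
  set π := Measure.pi fun _ : κ => μ
  let F : (κ → B) → ℝ≥0∞ := fun z => ⨆ S ∈ traces 𝓑 z, w S
  have hF : Measurable F := measurable_iSup_traces h𝓑_countable h𝓑_meas w
  have hσ (t : τ) : MeasurePreserving (fun z : κ → B => z ∘ σ t) π π :=
    measurePreserving_comp_perm (σ t)
  have h_sum : Fintype.card τ * ∫⁻ z, F z ∂π ≤ Fintype.card τ * C := by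
    calc Fintype.card τ * ∫⁻ z, F z ∂π = ∑ t, ∫⁻ z, F (z ∘ σ t) ∂π := by
          simp only [(hσ _).lintegral_comp hF, Finset.sum_const, Finset.card_univ, nsmul_eq_mul]
      _ = ∫⁻ z, ∑ t, F (z ∘ σ t) ∂π :=
          (lintegral_finsetSum _ fun t _ => hF.comp (hσ t).measurable).symm
      _ ≤ ∫⁻ _, Fintype.card τ * C ∂π := by
          refine lintegral_mono fun z => ?_
          calc ∑ t, F (z ∘ σ t) ≤ (traces 𝓑 z).encard * Fintype.card τ :=
                sum_iSup_traces_comp_le (fun t => σ t) hw z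
            _ ≤ Fintype.card τ * C := by
                rw [mul_comm]
                gcongr
                exact_mod_cast hC z
      _ = Fintype.card τ * C := by simp only [lintegral_const, measure_univ, mul_one]
  exact (ENNReal.mul_le_mul_iff_right (by simp) (by simp)).1 h_sum

end Symmetrization

section GhostSample

variable {ι : Type*}

/-- The permutation of the indices of a double sample that exchanges the two copies of `i`
whenever `s i` is true. -/
def sideSwap (s : ι → Bool) : Equiv.Perm (ι ⊕ ι) :=
  Function.Involutive.toPerm (fun q => bif s (q.elim id id) then q.swap else q) <| by
    rintro (i | i) <;> cases h : s i <;> simp [h]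

lemma sideSwap_inl (s : ι → Bool) (i : ι) :
    sideSwap s (.inl i) = bif s i then .inr i else .inl i :=
  rfl

lemma sideSwap_inr (s : ι → Bool) (i : ι) :
    sideSwap s (.inr i) = bif s i then .inl i else .inr i :=
  rfl

open Classical in
/-- The weight of a trace `S` on a double sample: it vanishes if `S` meets the first (left) sample
and otherwise doubles with each point of the second (right) sample, the ghost sample, in `S`. -/
noncomputable def ghostWeight [Fintype ι] (S : Set (ι ⊕ ι)) : ℝ≥0∞ :=
  ∏ i, (if .inl i ∈ S then 0 else 1) * (if .inr i ∈ S then 2 else 1)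

lemma sum_ghostWeight_sideSwap_le [Fintype ι] [DecidableEq ι] (S : Set (ι ⊕ ι)) :
    ∑ s : ι → Bool, ghostWeight (sideSwap s ⁻¹' S) ≤ Fintype.card (ι → Bool) := by
  classical
  let v (i : ι) (b : Bool) : ℝ≥0∞ :=
    (if (bif b then .inr i else .inl i) ∈ S then 0 else 1) *
      (if (bif b then .inl i else .inr i) ∈ S then 2 else 1)
  have h_factor (s : ι → Bool) : ghostWeight (sideSwap s ⁻¹' S) = ∏ i, v i (s i) := by
    simp only [ghostWeight, Set.mem_preimage, sideSwap_inl, sideSwap_inr, v]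
  have h_pair (i : ι) : ∑ b, v i b ≤ 2 := by
    by_cases hl : .inl i ∈ S <;> by_cases hr : .inr i ∈ S <;> simp [v, hl, hr, one_add_one_eq_two]
  calc ∑ s : ι → Bool, ghostWeight (sideSwap s ⁻¹' S) = ∏ i, ∑ b, v i b := by
        simp only [h_factor, Fintype.prod_sum]
    _ ≤ ∏ _ : ι, 2 := Finset.prod_le_prod' fun i _ => h_pair i
    _ = Fintype.card (ι → Bool) := by simp

variable {B : Type*} [MeasurableSpace B] {μ : Measure B} [IsProbabilityMeasure μ]
  {𝓑 : Set (Set B)} [Fintype ι]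

lemma lintegral_pi_prod_eval {f : B → ℝ≥0∞} (hf : Measurable f) :
    ∫⁻ y, ∏ i, f (y i) ∂Measure.pi (fun _ : ι => μ) = (∫⁻ b, f b ∂μ) ^ Fintype.card ι := by
  have h_eval (i : ι) : ∫⁻ y, f (y i) ∂Measure.pi (fun _ : ι => μ) = ∫⁻ b, f b ∂μ :=
    (measurePreserving_eval (fun _ => μ) i).lintegral_comp hf
  calc ∫⁻ y, ∏ i, f (y i) ∂Measure.pi (fun _ : ι => μ)
      = ∏ i, ∫⁻ y, f (y i) ∂Measure.pi (fun _ : ι => μ) :=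
        lintegral_prod_eq_prod_lintegral_of_indepFun Finset.univ (fun i (y : ι → B) => f (y i))
          (iIndepFun_pi fun _ => hf.aemeasurable) fun i => hf.comp (measurable_pi_apply i)
    _ = (∫⁻ b, f b ∂μ) ^ Fintype.card ι := by
        simp only [h_eval, Finset.prod_const, Finset.card_univ]

lemma lintegral_ghostWeight_preimage {T : Set B} (hT : MeasurableSet T) {x : ι → B}
    (hx : T ∩ Set.range x = ∅) :
    ∫⁻ y, ghostWeight (Sum.elim x y ⁻¹' T) ∂Measure.pi (fun _ : ι => μ) =
      (1 + μ T) ^ Fintype.card ι := by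
  classical
  have hxT (i : ι) : x i ∉ T := fun hi => (hx.le ⟨hi, i, rfl⟩ : x i ∈ (∅ : Set B))
  have h_weight (y : ι → B) :
      ghostWeight (Sum.elim x y ⁻¹' T) = ∏ i, (1 + T.indicator 1 (y i)) := by
    refine Finset.prod_congr rfl fun i _ => ?_
    by_cases hi : y i ∈ T <;> simp [hxT, hi, one_add_one_eq_two]
  have h_meas : Measurable fun b => 1 + T.indicator (1 : B → ℝ≥0∞) b :=
    (measurable_one.indicator hT).const_add 1
  have h_factor : ∫⁻ b, (1 + T.indicator (1 : B → ℝ≥0∞) b) ∂μ = 1 + μ T := by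
    rw [lintegral_add_left measurable_const, lintegral_indicator_one hT, lintegral_const,
      measure_univ, mul_one]
  simp only [h_weight]
  rw [lintegral_pi_prod_eval h_meas, h_factor]

lemma lintegral_lintegral_iSup_ghostWeight_le (h𝓑_countable : 𝓑.Countable)
    (h𝓑_meas : ∀ T ∈ 𝓑, MeasurableSet T) {C : ℕ} (hC : ∀ z : ι ⊕ ι → B, (traces 𝓑 z).encard ≤ C) :
    ∫⁻ x, ∫⁻ y, ⨆ S ∈ traces 𝓑 (Sum.elim x y), ghostWeight S
      ∂Measure.pi (fun _ : ι => μ) ∂Measure.pi (fun _ : ι => μ) ≤ C := by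
  classical
  let F : (ι ⊕ ι → B) → ℝ≥0∞ := fun z => ⨆ S ∈ traces 𝓑 z, ghostWeight S
  have hF : Measurable F := measurable_iSup_traces h𝓑_countable h𝓑_meas _
  have h_split : MeasurePreserving (fun p : (ι → B) × (ι → B) => Sum.elim p.1 p.2)
      ((Measure.pi fun _ => μ).prod (Measure.pi fun _ => μ)) (Measure.pi fun _ => μ) := by
    convert! measurePreserving_sumPiEquivProdPi_symm fun _ : ι ⊕ ι => μ
  calc ∫⁻ x, ∫⁻ y, F (Sum.elim x y) ∂Measure.pi (fun _ : ι => μ) ∂Measure.pi (fun _ : ι => μ)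
      = ∫⁻ p : (ι → B) × (ι → B), F (Sum.elim p.1 p.2)
          ∂(Measure.pi fun _ => μ).prod (Measure.pi fun _ => μ) :=
        (lintegral_prod _ (hF.comp h_split.measurable).aemeasurable).symm
    _ = ∫⁻ z, F z ∂Measure.pi (fun _ : ι ⊕ ι => μ) := h_split.lintegral_comp hF
    _ ≤ C := lintegral_iSup_traces_le h𝓑_countable h𝓑_meas hC sideSwap
        sum_ghostWeight_sideSwap_le

end GhostSample

section Dispersion

variable {B : Type*} [MeasurableSpace B] {μ : Measure B} {𝓑 : Set (Set B)} {P : Set B}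

lemma dispersion_nonneg : 0 ≤ dispersion μ 𝓑 P :=
  Real.sSup_nonneg (by rintro _ ⟨T, -, -, rfl⟩; exact measureReal_nonneg)

variable [IsFiniteMeasure μ]

lemma bddAbove_measureReal_of_inter_eq_empty :
    BddAbove {r : ℝ | ∃ T ∈ 𝓑, T ∩ P = ∅ ∧ r = μ.real T} :=
  ⟨μ.real Set.univ, by rintro _ ⟨T, -, -, rfl⟩; exact measureReal_mono T.subset_univ⟩

lemma dispersion_mem_of_isClosed {K : Set ℝ} (hK : IsClosed K) (h_zero : 0 ∈ K)
    (h : ∀ T ∈ 𝓑, T ∩ P = ∅ → μ.real T ∈ K) : dispersion μ 𝓑 P ∈ K := by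
  have h_subset : {r : ℝ | ∃ T ∈ 𝓑, T ∩ P = ∅ ∧ r = μ.real T} ⊆ K := by
    rintro _ ⟨T, hT, hTP, rfl⟩
    exact h T hT hTP
  rcases Set.eq_empty_or_nonempty {r : ℝ | ∃ T ∈ 𝓑, T ∩ P = ∅ ∧ r = μ.real T} with h_empty | h_ne
  · rwa [dispersion, h_empty, Real.sSup_empty]
  · exact hK.closure_subset_iff.2 h_subset
      (csSup_mem_closure h_ne bddAbove_measureReal_of_inter_eq_empty)

lemma dispersion_le_iff {c : ℝ} (hc : 0 ≤ c) :
    dispersion μ 𝓑 P ≤ c ↔ ∀ T ∈ 𝓑, T ∩ P = ∅ → μ.real T ≤ c :=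
  ⟨fun h T hT hTP => (le_csSup bddAbove_measureReal_of_inter_eq_empty
      ⟨T, hT, hTP, rfl⟩).trans h,
    fun h => dispersion_mem_of_isClosed isClosed_Iic hc h⟩

lemma measurable_dispersion_range (h𝓑_countable : 𝓑.Countable)
    (h𝓑_meas : ∀ T ∈ 𝓑, MeasurableSet T) {ι : Type*} [Countable ι] :
    Measurable fun x : ι → B => dispersion μ 𝓑 (Set.range x) := by
  have h_miss (T : Set B) (hT : T ∈ 𝓑) : MeasurableSet {x : ι → B | T ∩ Set.range x = ∅} := by
    have h_eq : {x : ι → B | T ∩ Set.range x = ∅} = ⋂ i, (· i) ⁻¹' Tᶜ := by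
      ext x
      simp [← Set.disjoint_iff_inter_eq_empty, Set.disjoint_right]
    rw [h_eq]
    exact .iInter fun i => measurable_pi_apply i (h𝓑_meas T hT).compl
  refine measurable_of_Iic fun c => ?_
  rcases lt_or_ge c 0 with hc | hc
  · convert! MeasurableSet.empty
    exact Set.eq_empty_of_forall_notMem fun x hx => (hc.trans_le dispersion_nonneg).not_ge hx
  · have h_eq : (fun x : ι → B => dispersion μ 𝓑 (Set.range x)) ⁻¹' Set.Iic c =
        ⋂ T ∈ 𝓑, {x | T ∩ Set.range x = ∅ → μ.real T ≤ c} := by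
      ext x
      simp [dispersion_le_iff hc]
    rw [h_eq]
    exact .biInter h𝓑_countable fun T hT => (h_miss T hT).himp (.const _)

lemma integrable_dispersion_range (h𝓑_countable : 𝓑.Countable)
    (h𝓑_meas : ∀ T ∈ 𝓑, MeasurableSet T) {ι Ω : Type*} [Countable ι] [MeasurableSpace Ω]
    {Pr : Measure Ω} [IsFiniteMeasure Pr] {X : ι → Ω → B} (hX : ∀ i, AEMeasurable (X i) Pr) :
    Integrable (fun ω => dispersion μ 𝓑 (Set.range fun i => X i ω)) Pr := by
  refine .of_bound ((measurable_dispersion_range h𝓑_countable h𝓑_meas).comp_aemeasurable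
    (aemeasurable_pi_lambda _ hX)).aestronglyMeasurable (μ.real Set.univ) (ae_of_all _ fun ω => ?_)
  rw [Real.norm_of_nonneg dispersion_nonneg]
  exact (dispersion_le_iff measureReal_nonneg).2 fun T _ _ => measureReal_mono T.subset_univ

end Dispersion

section ExponentialMoment

lemma integral_le_logb_of_lintegral_rpow_le {Ω : Type*} [MeasurableSpace Ω] {Pr : Measure Ω}
    [IsProbabilityMeasure Pr] {f : Ω → ℝ} (hf : Integrable f Pr) {b A : ℝ} (hb : 1 < b)
    (hA : 0 < A) (h : ∫⁻ ω, ENNReal.ofReal (b ^ f ω) ∂Pr ≤ ENNReal.ofReal A) :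
    ∫ ω, f ω ∂Pr ≤ Real.logb b A := by
  have hb_pos : 0 < b := zero_lt_one.trans hb
  have h_meas : AEStronglyMeasurable (fun ω => b ^ f ω) Pr :=
    (hf.aemeasurable.const_pow b).aestronglyMeasurable
  have h_nonneg : 0 ≤ᵐ[Pr] fun ω => b ^ f ω := ae_of_all _ fun ω => by positivity
  have h_int : Integrable (fun ω => b ^ f ω) Pr :=
    (lintegral_ofReal_ne_top_iff_integrable h_meas h_nonneg).1
      (ne_top_of_le_ne_top ENNReal.ofReal_ne_top h)
  rw [Real.le_logb_iff_rpow_le hb hA]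
  calc b ^ ∫ ω, f ω ∂Pr ≤ ∫ ω, b ^ f ω ∂Pr :=
        (convexOn_rpow_left hb_pos).map_integral_le
          (Real.continuous_const_rpow hb_pos.ne').continuousOn isClosed_univ
          (ae_of_all _ fun _ => Set.mem_univ _) hf h_int
    _ ≤ A := by
        rw [integral_eq_lintegral_of_nonneg_ae h_nonneg h_meas]
        exact ENNReal.toReal_le_of_le_ofReal hA.le h

variable {B Ω ι : Type*} [MeasurableSpace B] [MeasurableSpace Ω] [Fintype ι] {μ : Measure B}
  [IsProbabilityMeasure μ] {𝓑 : Set (Set B)} {Pr : Measure Ω}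

lemma ofReal_two_rpow_mul_measureReal_le (T : Set B) (n : ℕ) :
    ENNReal.ofReal (2 ^ (n * μ.real T)) ≤ (1 + μ T) ^ n := by
  have h_bernoulli : (2 : ℝ) ^ μ.real T ≤ 1 + μ.real T := by
    simpa [one_add_one_eq_two] using rpow_one_add_le_one_add_mul_self (s := 1) (by norm_num)
      (measureReal_nonneg (μ := μ) (s := T)) measureReal_le_one
  calc ENNReal.ofReal (2 ^ (n * μ.real T)) = ENNReal.ofReal (2 ^ μ.real T) ^ n := by
        rw [mul_comm, Real.rpow_mul_natCast zero_le_two, ENNReal.ofReal_pow (by positivity)]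
    _ ≤ ENNReal.ofReal (1 + μ.real T) ^ n := by gcongr
    _ = (1 + μ T) ^ n := by
        rw [ENNReal.ofReal_add zero_le_one measureReal_nonneg, ENNReal.ofReal_one,
          ofReal_measureReal]

lemma ofReal_two_rpow_dispersion_le (h𝓑_meas : ∀ T ∈ 𝓑, MeasurableSet T) (x : ι → B) :
    ENNReal.ofReal (2 ^ (Fintype.card ι * dispersion μ 𝓑 (Set.range x))) ≤
      1 + ∫⁻ y, ⨆ S ∈ traces 𝓑 (Sum.elim x y), ghostWeight S ∂Measure.pi (fun _ : ι => μ) := by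
  set G := 1 + ∫⁻ y, ⨆ S ∈ traces 𝓑 (Sum.elim x y), ghostWeight S ∂Measure.pi (fun _ : ι => μ)
  have h_cont : Continuous fun r : ℝ => ENNReal.ofReal (2 ^ (Fintype.card ι * r)) :=
    ENNReal.continuous_ofReal.comp
      ((Real.continuous_const_rpow two_ne_zero).comp (continuous_const_mul _))
  refine dispersion_mem_of_isClosed (K := {r | ENNReal.ofReal (2 ^ (Fintype.card ι * r)) ≤ G})
    (isClosed_le h_cont continuous_const) ?_ fun T hT hTx => ?_
  · simp [G]
  · calc ENNReal.ofReal (2 ^ (Fintype.card ι * μ.real T))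
        ≤ (1 + μ T) ^ Fintype.card ι := ofReal_two_rpow_mul_measureReal_le T _
      _ = ∫⁻ y, ghostWeight (Sum.elim x y ⁻¹' T) ∂Measure.pi (fun _ : ι => μ) :=
          (lintegral_ghostWeight_preimage (h𝓑_meas T hT) hTx).symm
      _ ≤ ∫⁻ y, ⨆ S ∈ traces 𝓑 (Sum.elim x y), ghostWeight S ∂Measure.pi (fun _ : ι => μ) :=
          lintegral_mono fun y => le_iSup₂_of_le _ ⟨T, hT, rfl⟩ le_rfl
      _ ≤ G := le_add_self

lemma lintegral_two_rpow_dispersion_le (h𝓑_countable : 𝓑.Countable)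
    (h𝓑_meas : ∀ T ∈ 𝓑, MeasurableSet T) {C : ℕ} (hC : ∀ z : ι ⊕ ι → B, (traces 𝓑 z).encard ≤ C) :
    ∫⁻ x, ENNReal.ofReal (2 ^ (Fintype.card ι * dispersion μ 𝓑 (Set.range x)))
      ∂Measure.pi (fun _ : ι => μ) ≤ 1 + C := by
  calc _ ≤ ∫⁻ x, (1 + ∫⁻ y, ⨆ S ∈ traces 𝓑 (Sum.elim x y), ghostWeight S
          ∂Measure.pi (fun _ : ι => μ)) ∂Measure.pi (fun _ : ι => μ) :=
        lintegral_mono (ofReal_two_rpow_dispersion_le h𝓑_meas)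
    _ = 1 + ∫⁻ x, ∫⁻ y, ⨆ S ∈ traces 𝓑 (Sum.elim x y), ghostWeight S
          ∂Measure.pi (fun _ : ι => μ) ∂Measure.pi (fun _ : ι => μ) := by
        rw [lintegral_add_left measurable_const, lintegral_const, measure_univ, mul_one]
    _ ≤ 1 + C := by
        gcongr
        exact lintegral_lintegral_iSup_ghostWeight_le h𝓑_countable h𝓑_meas hC

lemma card_mul_integral_dispersion_le_logb [IsProbabilityMeasure Pr]
    (h𝓑_countable : 𝓑.Countable) (h𝓑_meas : ∀ T ∈ 𝓑, MeasurableSet T) {C : ℕ}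
    (hC : ∀ z : ι ⊕ ι → B, (traces 𝓑 z).encard ≤ C) {X : ι → Ω → B} (hX_indep : iIndepFun X Pr)
    (hX_law : ∀ i, HasLaw (X i) μ Pr) :
    Fintype.card ι * ∫ ω, dispersion μ 𝓑 (Set.range fun i => X i ω) ∂Pr ≤
      Real.logb 2 (1 + C) := by
  have h_int : Integrable (fun ω => dispersion μ 𝓑 (Set.range fun i => X i ω)) Pr :=
    integrable_dispersion_range h𝓑_countable h𝓑_meas fun i => (hX_law i).aemeasurable
  have h_meas : Measurable fun x : ι → B =>
      ENNReal.ofReal (2 ^ (Fintype.card ι * dispersion μ 𝓑 (Set.range x))) :=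
    (((measurable_dispersion_range h𝓑_countable h𝓑_meas).const_mul _).const_pow 2).ennreal_ofReal
  rw [← integral_const_mul]
  refine integral_le_logb_of_lintegral_rpow_le (h_int.const_mul _) one_lt_two (by positivity) ?_
  calc ∫⁻ ω, ENNReal.ofReal (2 ^ (Fintype.card ι * dispersion μ 𝓑 (Set.range fun i => X i ω))) ∂Pr
      = ∫⁻ x, ENNReal.ofReal (2 ^ (Fintype.card ι * dispersion μ 𝓑 (Set.range x)))
          ∂Measure.pi (fun _ : ι => μ) :=
        (hX_indep.hasLaw_pi hX_law).lintegral_comp h_meas.aemeasurable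
    _ ≤ 1 + C := lintegral_two_rpow_dispersion_le h𝓑_countable h𝓑_meas hC
    _ = ENNReal.ofReal (1 + C) := by
        rw [ENNReal.ofReal_add zero_le_one C.cast_nonneg, ENNReal.ofReal_one,
          ENNReal.ofReal_natCast]

theorem card_mul_integral_dispersion_le_of_setVCDim_le [IsProbabilityMeasure Pr]
    (h𝓑_countable : 𝓑.Countable) (h𝓑_meas : ∀ T ∈ 𝓑, MeasurableSet T) {d : ℕ}
    (hd : setVCDim 𝓑 ≤ d) (hd_pos : 0 < d) (hd_le : d ≤ 2 * Fintype.card ι)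
    {X : ι → Ω → B} (hX_indep : iIndepFun X Pr) (hX_law : ∀ i, HasLaw (X i) μ Pr) :
    Fintype.card ι * ∫ ω, dispersion μ 𝓑 (Set.range fun i => X i ω) ∂Pr ≤
      d * Real.logb 2 (4 * (Real.exp 1 * Fintype.card ι / d)) := by
  have hC (z : ι ⊕ ι → B) :
      (traces 𝓑 z).encard ≤ (∑ k ∈ Finset.Iic d, (2 * Fintype.card ι).choose k : ℕ) := by
    simpa only [Fintype.card_sum, ← two_mul] using
      encard_le_sum_choose_of_setVCDim_le ((setVCDim_traces_le 𝓑 z).trans hd)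
  refine (card_mul_integral_dispersion_le_logb h𝓑_countable h𝓑_meas hC hX_indep hX_law).trans ?_
  simpa only [Nat.cast_sum] using logb_one_add_sum_choose_two_mul_le hd_pos hd_le

end ExponentialMoment

lemma logb_two_four_mul_le {q : ℝ} (hq : 2 ≤ q) : Real.logb 2 (4 * q) ≤ 4 * Real.logb 2 q := by
  have hq_pow : 4 * q ≤ q ^ 4 := by nlinarith [pow_le_pow_left₀ zero_le_two hq 3]
  calc Real.logb 2 (4 * q) ≤ Real.logb 2 (q ^ 4) :=
        Real.logb_le_logb_of_le one_lt_two (by linarith) hq_pow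
    _ = 4 * Real.logb 2 q := by rw [Real.logb_pow, Nat.cast_ofNat]

theorem mainTheorem3 {B Ω : Type*} [MeasurableSpace B] [MeasurableSpace Ω]
    (μ : Measure B) [IsProbabilityMeasure μ]
    (𝓑 : Set (Set B)) (h𝓑_countable : 𝓑.Countable) (h𝓑_meas : ∀ T ∈ 𝓑, MeasurableSet T)
    (d : ℕ) (hd : setVCDim 𝓑 = d) (hd_pos : 1 ≤ d)
    (Pr : Measure Ω) [IsProbabilityMeasure Pr]
    (n : ℕ) (hn : d ≤ n)
    (X : Fin n → Ω → B) (hX_indep : iIndepFun X Pr) (hX_law : ∀ i, HasLaw (X i) μ Pr) :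
    Integrable (fun ω => dispersion μ 𝓑 (Set.range fun i => X i ω)) Pr ∧
      ∫ ω, dispersion μ 𝓑 (Set.range fun i => X i ω) ∂Pr ≤
        4 * (d : ℝ) / n * Real.logb 2 (Real.exp 1 * n / d) := by
  refine ⟨integrable_dispersion_range h𝓑_countable h𝓑_meas fun i => (hX_law i).aemeasurable, ?_⟩
  have hd_cast : (0 : ℝ) < d := by exact_mod_cast hd_pos
  have hn_cast : (0 : ℝ) < n := by exact_mod_cast hd_pos.trans hn
  have h_ratio : 2 ≤ Real.exp 1 * n / d := by
    rw [mul_div_assoc]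
    have h_exp : 2 ≤ Real.exp 1 := by linarith [Real.add_one_le_exp (1 : ℝ)]
    have h_one : 1 ≤ (n : ℝ) / d := (one_le_div hd_cast).2 (by exact_mod_cast hn)
    nlinarith
  have h_mean := card_mul_integral_dispersion_le_of_setVCDim_le h𝓑_countable h𝓑_meas hd.le hd_pos
    (by rw [Fintype.card_fin]; lia) hX_indep hX_law
  rw [Fintype.card_fin] at h_mean
  rw [div_mul_eq_mul_div, le_div_iff₀' hn_cast]
  calc n * ∫ ω, dispersion μ 𝓑 (Set.range fun i => X i ω) ∂Pr
      ≤ d * Real.logb 2 (4 * (Real.exp 1 * n / d)) := h_mean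
    _ ≤ d * (4 * Real.logb 2 (Real.exp 1 * n / d)) := by
        gcongr
        exact logb_two_four_mul_le h_ratio
    _ = 4 * d * Real.logb 2 (Real.exp 1 * n / d) := by ring
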